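/- Let $k\ge 1$ be an integer and let $r_k(n)$ denote the number of representations of $n$ as a sum of $k$ squares of integers (order and signs counted). Put $\nu=\frac k4-\frac12$. Let $J_\nu$ and $I_\nu$ be the Bessel and modified Bessel functions of the first kind, $$J_\nu(z)=\Big(\frac z2\Big)^{\nu}\sum_{m\ge 0}\frac{(-1)^m (z/2)^{2m}}{m!\,\Gamma(\nu+m+1)},\qquad I_\nu(z)=\Big(\frac z2\Big)^{\nu}\sum_{m\ge 0}\frac{(z/2)^{2m}}{m!\,\Gamma(\nu+m+1)}.$$ Let $x,y\in\mathbb C$, with $y\ne 0$ if $k=1$. (i) If $\operatorname{Re}(x)>|\operatorname{Im}(y)|$, then $$\frac{(\pi y)^{\nu}}{2^{\nu}\Gamma(\frac k4+\frac12)}+\sum_{n=1}^\infty \frac{r_k(n)}{n^{\nu}}e^{-\pi n x}J_\nu(\pi n y)=\frac{(\pi y)^{\nu}}{2^{\nu}\Gamma(\frac k4+\frac12)\,(x^2+y^2)^{k/4}}+\frac1{\sqrt{x^2+y^2}}\sum_{n=1}^\infty \frac{r_k(n)}{n^{\nu}}e^{-\frac{\pi n x}{x^2+y^2}}J_\nu\Big(\frac{\pi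 n y}{x^2+y^2}\Big).$$ (ii) If $\operatorname{Re}(x)>|\operatorname{Re}(y)|$, then $$\frac{(\pi y)^{\nu}}{2^{\nu}\Gamma(\frac k4+\frac12)}+\sum_{n=1}^\infty \frac{r_k(n)}{n^{\nu}}e^{-\pi n x}I_\nu(\pi n y)=\frac{(\pi y)^{\nu}}{2^{\nu}\Gamma(\frac k4+\frac12)\,(x^2-y^2)^{k/4}}+\frac1{\sqrt{x^2-y^2}}\sum_{n=1}^\infty \frac{r_k(n)}{n^{\nu}}e^{-\frac{\pi n x}{x^2-y^2}}I_\nu\Big(\frac{\pi n y}{x^2-y^2}\Big).$$ All four series converge absolutely. The branches are as follows. With $D=x^2+y^2$ in (i) and $D=x^2-y^2$ in (ii), $\sqrt D$ and $D^{k/4}$ have their principal values. An arbitrary determination $\theta$ of $\arg y$ is fixed; $(\pi y)^\nu$ and the factor $(\pi n y/2)^\nu$ of the Bessel functions on the left are taken with $\theta$, and the factor $(\pi n y/(2D))^\nu$ of the Bessel functions on the right is taken with $\theta-\operatorname{Arg} D$, where $\operatorname{Arg}$ is the principal argument. -/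

import Mathlib

noncomputable section

/-- `r_k(n)`: the number of representations of `n` as a sum of `k` squares of integers
(order and signs matter). -/
def sumSqReps (k n : ℕ) : ℕ :=
  Set.ncard {v : Fin k → ℤ | ∑ i, v i ^ 2 = (n : ℤ)}

/-- The set counted by `sumSqReps` is finite, so that its cardinality is the true one. -/
theorem sumSqReps_finite (k n : ℕ) : {v : Fin k → ℤ | ∑ i, v i ^ 2 = (n : ℤ)}.Finite := by
  refine (Set.finite_Icc (fun _ : Fin k => -(n : ℤ)) (fun _ => (n : ℤ))).subset ?_
  intro v hv
  have hv' : ∑ i, v i ^ 2 = (n : ℤ) := hv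
  have key : ∀ i, v i ^ 2 ≤ (n : ℤ) := fun i => by
    rw [← hv']
    exact Finset.single_le_sum (f := fun j => v j ^ 2) (fun j _ => sq_nonneg _)
      (Finset.mem_univ i)
  refine ⟨fun i => ?_, fun i => ?_⟩
  · show -(n : ℤ) ≤ v i
    have := key i
    nlinarith [sq_nonneg (v i + 1), Int.le_self_sq (-(v i))]
  · show v i ≤ (n : ℤ)
    exact (Int.le_self_sq (v i)).trans (key i)

/-- `θ` is a determination of the argument of `z` (every real number is one if `z = 0`). -/
def IsArgOf (θ : ℝ) (z : ℂ) : Prop :=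
  (‖z‖ : ℂ) * Complex.exp (θ * Complex.I) = z

/-- The value of `z ^ ν` belonging to the determination `θ` of the argument of `z`. -/
def powAt (z : ℂ) (θ : ℝ) (ν : ℂ) : ℂ :=
  (‖z‖ : ℂ) ^ ν * Complex.exp (ν * (θ * Complex.I))

/-- The Bessel function of the first kind `J_ν(z)`; the factor `(z / 2) ^ ν` is taken with the
determination `θ` of the argument of `z`. -/
def besselJAt (ν z : ℂ) (θ : ℝ) : ℂ :=
  powAt (z / 2) θ ν *
    ∑' m : ℕ, (-1) ^ m * (z / 2) ^ (2 * m) / ((m.factorial : ℂ) * Complex.Gamma (ν + m + 1))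

/-- The modified Bessel function of the first kind `I_ν(z)`; the factor `(z / 2) ^ ν` is taken
with the determination `θ` of the argument of `z`. -/
def besselIAt (ν z : ℂ) (θ : ℝ) : ℂ :=
  powAt (z / 2) θ ν *
    ∑' m : ℕ, (z / 2) ^ (2 * m) / ((m.factorial : ℂ) * Complex.Gamma (ν + m + 1))

/-- The principal argument gives the principal power. -/
theorem powAt_arg (z ν : ℂ) : powAt z z.arg ν = z ^ ν := by
  unfold powAt
  rcases eq_or_ne z 0 with rfl | hz
  · simp
  · have hn : (‖z‖ : ℂ) ≠ 0 := by simpa using hz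
    rw [Complex.cpow_def_of_ne_zero hn, Complex.cpow_def_of_ne_zero hz, ← Complex.exp_add,
      ← Complex.ofReal_log (norm_nonneg z)]
    congr 1
    rw [Complex.log]
    ring

/-- The principal argument gives the principal value of `J_ν`. -/
theorem besselJAt_arg (ν z : ℂ) : besselJAt ν z z.arg = (z / 2) ^ ν *
    ∑' m : ℕ, (-1) ^ m * (z / 2) ^ (2 * m) /
      ((m.factorial : ℂ) * Complex.Gamma (ν + m + 1)) := by
  have h : z.arg = (z / 2).arg := by
    rw [div_eq_inv_mul, show (2⁻¹ : ℂ) = ((2⁻¹ : ℝ) : ℂ) by push_cast; rfl,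
      Complex.arg_real_mul z (by norm_num)]
  rw [besselJAt, h, powAt_arg]

/-- The principal argument gives the principal value of `I_ν`. -/
theorem besselIAt_arg (ν z : ℂ) : besselIAt ν z z.arg = (z / 2) ^ ν *
    ∑' m : ℕ, (z / 2) ^ (2 * m) / ((m.factorial : ℂ) * Complex.Gamma (ν + m + 1)) := by
  have h : z.arg = (z / 2).arg := by
    rw [div_eq_inv_mul, show (2⁻¹ : ℂ) = ((2⁻¹ : ℝ) : ℂ) by push_cast; rfl,
      Complex.arg_real_mul z (by norm_num)]
  rw [besselIAt, h, powAt_arg]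

/-- The terms, for `n ≥ 1`, of the Bessel series
`∑ r_k(n) n^(1/2 - k/4) e^(-π n X) J_(k/4 - 1/2)(π n Y)`, with the determination `θ` of the
argument of `Y`. -/
def thetaJTerm (k : ℕ) (X Y : ℂ) (θ : ℝ) (n : ℕ+) : ℂ :=
  (sumSqReps k n : ℂ) / ((n : ℕ) : ℂ) ^ ((k : ℂ) / 4 - 1 / 2) *
    Complex.exp (-(Real.pi * (n : ℕ) * X)) *
    besselJAt ((k : ℂ) / 4 - 1 / 2) (Real.pi * (n : ℕ) * Y) θ

/-- The terms, for `n ≥ 1`, of the Bessel series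
`∑ r_k(n) n^(1/2 - k/4) e^(-π n X) I_(k/4 - 1/2)(π n Y)`, with the determination `θ` of the
argument of `Y`. -/
def thetaITerm (k : ℕ) (X Y : ℂ) (θ : ℝ) (n : ℕ+) : ℂ :=
  (sumSqReps k n : ℂ) / ((n : ℕ) : ℂ) ^ ((k : ℂ) / 4 - 1 / 2) *
    Complex.exp (-(Real.pi * (n : ℕ) * X)) *
    besselIAt ((k : ℂ) / 4 - 1 / 2) (Real.pi * (n : ℕ) * Y) θ

/-- The constant term `(π y)^(k/4 - 1/2) / (2^(k/4 - 1/2) Γ(k/4 + 1/2))`, with the determination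
`θ` of the argument of `y`. -/
def thetaConst (k : ℕ) (y : ℂ) (θ : ℝ) : ℂ :=
  powAt (Real.pi * y) θ ((k : ℂ) / 4 - 1 / 2) /
    ((2 : ℂ) ^ ((k : ℂ) / 4 - 1 / 2) * Complex.Gamma ((k : ℂ) / 4 + 1 / 2))

end

noncomputable section

open MeasureTheory Set

/-! Put `a = k/4`, so that `ν = a - 1/2`. Poisson's integral (`integral_betaWeight_mul_exp`) writes
`I_ν(z)` as a constant times `z^ν ∫₀¹ (s(1-s))^(a-1) exp (z(2s-1)) ds`. Hence `n^(-ν) exp (-π n x)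
I_ν(π n y)` is, up to a factor independent of `n` (`besselFactor`), the Beta-weighted mean of `exp
(-π n τ)` over the segment from `x - y` to `x + y`. Summing against `r_k(n)` gives the mean of
`sqTheta τ ^ k`, with the term `n = 0` supplying the constant term of the formula. The case of `J_ν`
is the same with the segment from `x - i y` to `x + i y`.

Since `sqTheta ^ k` has weight `k/2 = 2a` under `τ ↦ 1/τ`, and this matches the exponent `a - 1` of
the weight, the mean over the segment with endpoints `w, w'` equals `(w w')^(-a)` times the mean
over the segment with endpoints `1/w, 1/w'` (`betaMean_inv`). For positive real endpoints this is a
Möbius change of variable; the identity theorem, used in one endpoint at a time, extends it to the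
right half-plane. With `w, w' = x ± y` one has `D = w w'`, and the inverted endpoints are `(x ∓
y)/D`, which are the parameters of the right-hand side. -/

/-! ### Moments of the symmetric Beta weight and Poisson's integral. -/

/-- The symmetric Beta weight `(s (1 - s)) ^ (a - 1)`. -/
def betaWeight (a s : ℝ) : ℝ := (s * (1 - s)) ^ (a - 1)

theorem betaWeight_nonneg {a s : ℝ} (hs : s ∈ Ioo (0 : ℝ) 1) : 0 ≤ betaWeight a s :=
  Real.rpow_nonneg (mul_nonneg hs.1.le (by linarith [hs.2])) _

theorem betaWeight_eq_cpow {a s : ℝ} (hs : s ∈ Ioo (0 : ℝ) 1) :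
    (betaWeight a s : ℂ) = (s : ℂ) ^ ((a : ℂ) - 1) * (1 - (s : ℂ)) ^ ((a : ℂ) - 1) := by
  have h1 : (0 : ℝ) ≤ 1 - s := by linarith [hs.2]
  rw [betaWeight, Real.mul_rpow hs.1.le h1, Complex.ofReal_mul, Complex.ofReal_cpow hs.1.le,
    Complex.ofReal_cpow h1]
  push_cast
  rfl

theorem integrableOn_betaWeight_ofReal {a : ℝ} (ha : 0 < a) :
    IntegrableOn (fun s => (betaWeight a s : ℂ)) (Ioo 0 1) := by
  have h := Complex.betaIntegral_convergent (u := a) (v := a) (by simpa) (by simpa)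
  rw [intervalIntegrable_iff_integrableOn_Ioo_of_le zero_le_one] at h
  exact h.congr_fun (fun s hs => (betaWeight_eq_cpow hs).symm) measurableSet_Ioo

theorem integrableOn_betaWeight {a : ℝ} (ha : 0 < a) :
    IntegrableOn (betaWeight a) (Ioo 0 1) := by
  have h := (integrableOn_betaWeight_ofReal ha).re
  simpa [IntegrableOn] using h

/-- This is `B(a, a)` rewritten by the duplication formula; `Γ(1/2)` is left unevaluated so that the
formula is the case `m = 0` of the even moments. -/
theorem integral_betaWeight {a : ℝ} (ha : 0 < a) :
    ∫ s in Ioo (0 : ℝ) 1, betaWeight a s =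
      2 ^ (1 - 2 * a) * Real.Gamma (1 / 2) * Real.Gamma a / Real.Gamma (1 / 2 + a) := by
  have h := Complex.Gamma_mul_Gamma_eq_betaIntegral (s := a) (t := a) (by simpa) (by simpa)
  have hb : Complex.betaIntegral a a = ((∫ s in Ioo (0 : ℝ) 1, betaWeight a s : ℝ) : ℂ) := by
    rw [Complex.betaIntegral, intervalIntegral.integral_of_le zero_le_one,
      integral_Ioc_eq_integral_Ioo, ← integral_complex_ofReal]
    exact setIntegral_congr_fun measurableSet_Ioo fun s hs => (betaWeight_eq_cpow hs).symm
  rw [hb, ← Complex.ofReal_add, Complex.Gamma_ofReal, Complex.Gamma_ofReal] at h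
  norm_cast at h
  have hd := Real.Gamma_mul_Gamma_add_half a
  have h2 := Real.Gamma_pos_of_pos ha
  have h3 := Real.Gamma_pos_of_pos (show 0 < a + a by linarith)
  have h4 := Real.Gamma_pos_of_pos (show 0 < a + 1 / 2 by linarith)
  rw [Real.Gamma_one_half_eq, add_comm (1 / 2), eq_div_iff h4.ne']
  rw [← two_mul] at h h3
  apply mul_left_cancel₀ h3.ne'
  rw [← mul_assoc, ← h, mul_assoc, hd]
  ring

theorem integrableOn_betaWeight_mul {E : Type*} [NormedAddCommGroup E] [NormedSpace ℝ E]
    {a : ℝ} (ha : 0 < a) {g : ℝ → E}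
    (hg : ContinuousOn g (Icc 0 1)) :
    IntegrableOn (fun s => betaWeight a s • g s) (Ioo 0 1) := by
  have h := (integrableOn_Icc_iff_integrableOn_Ioo (μ := volume)).2 (integrableOn_betaWeight ha)
  exact (h.smul_continuousOn hg isCompact_Icc).mono_set Ioo_subset_Icc_self

/-- The even moments of the symmetric Beta weight about its centre. -/
theorem integral_betaWeight_mul_pow (m : ℕ) : ∀ {a : ℝ}, 0 < a →
    ∫ s in Ioo (0 : ℝ) 1, betaWeight a s * (2 * s - 1) ^ (2 * m) =
      2 ^ (1 - 2 * a) * Real.Gamma (m + 1 / 2) * Real.Gamma a / Real.Gamma (m + 1 / 2 + a) := by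
  induction m with
  | zero =>
    intro a ha
    simpa using integral_betaWeight ha
  | succ m ih =>
    intro a ha
    have hint : ∀ {b : ℝ}, 0 < b →
        IntegrableOn (fun s => betaWeight b s * (2 * s - 1) ^ (2 * m)) (Ioo 0 1) := fun hb =>
      integrableOn_betaWeight_mul hb (by fun_prop)
    -- Since `(2s - 1)² = 1 - 4 s(1 - s)`, and `s(1 - s)` raises the parameter of the weight by one,
    -- the moment for `m + 1` reduces to those for `m` at `a` and `a + 1`.
    have hsplit : ∫ s in Ioo (0 : ℝ) 1, betaWeight a s * (2 * s - 1) ^ (2 * (m + 1)) =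
        (∫ s in Ioo (0 : ℝ) 1, betaWeight a s * (2 * s - 1) ^ (2 * m)) -
          4 * ∫ s in Ioo (0 : ℝ) 1, betaWeight (a + 1) s * (2 * s - 1) ^ (2 * m) := by
      rw [← integral_const_mul, ← integral_sub (hint ha) ((hint (by linarith)).const_mul 4)]
      refine setIntegral_congr_fun measurableSet_Ioo fun s hs => ?_
      have hp : 0 < s * (1 - s) := mul_pos hs.1 (by linarith [hs.2])
      have : betaWeight (a + 1) s = betaWeight a s * (s * (1 - s)) := by
        rw [betaWeight, betaWeight, ← Real.rpow_add_one hp.ne']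
        ring_nf
      simp only [this]
      ring
    have h1 : (0 : ℝ) < m + 1 / 2 := by positivity
    have h2 : (0 : ℝ) < m + 1 / 2 + a := by positivity
    have hg := Real.Gamma_pos_of_pos h2
    rw [hsplit, ih ha, ih (by linarith), Real.Gamma_add_one ha.ne',
      show ((m + 1 : ℕ) : ℝ) + 1 / 2 = (m + 1 / 2) + 1 by push_cast; ring,
      Real.Gamma_add_one h1.ne', show (m : ℝ) + 1 / 2 + 1 + a = (m + 1 / 2 + a) + 1 by ring,
      Real.Gamma_add_one h2.ne', show (m : ℝ) + 1 / 2 + (a + 1) = (m + 1 / 2 + a) + 1 by ring,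
      Real.Gamma_add_one h2.ne', show 1 - 2 * (a + 1) = (1 - 2 * a) - 2 by ring,
      Real.rpow_sub two_pos (1 - 2 * a) 2, Real.rpow_two]
    generalize (2 : ℝ) ^ (1 - 2 * a) = c
    generalize Real.Gamma ((m : ℝ) + 1 / 2 + a) = g at *
    field_simp
    ring

/-- In Poisson's integral this turns the `(2m)!` of the cosh series into the `m!` of the Bessel
series. -/
theorem Gamma_nat_add_half_eq (m : ℕ) :
    Real.Gamma (m + 1 / 2) * (4 ^ m * m.factorial) = (2 * m).factorial * √Real.pi := by
  induction m with
  | zero => simp [-one_div, Real.Gamma_one_half_eq]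
  | succ m ih =>
    have h1 : (m : ℝ) + 1 / 2 ≠ 0 := by positivity
    rw [show ((m + 1 : ℕ) : ℝ) + 1 / 2 = (m + 1 / 2) + 1 by push_cast; ring,
      Real.Gamma_add_one h1, show 2 * (m + 1) = 2 * m + 1 + 1 by ring, Nat.factorial_succ,
      Nat.factorial_succ, Nat.factorial_succ]
    push_cast
    linear_combination (4 * (m + 1 / 2) * (m + 1) : ℝ) * ih

theorem integral_betaWeight_smul_swap {E : Type*} [NormedAddCommGroup E] [NormedSpace ℝ E]
    (a : ℝ) (g : ℝ → E) :
    ∫ s in Ioo (0 : ℝ) 1, betaWeight a s • g (1 - s) =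
      ∫ s in Ioo (0 : ℝ) 1, betaWeight a s • g s := by
  have h := intervalIntegral.integral_comp_sub_left (a := 0) (b := 1)
    (fun s => betaWeight a s • g s) 1
  simp only [sub_zero, sub_self] at h
  rw [intervalIntegral.integral_of_le zero_le_one, integral_Ioc_eq_integral_Ioo,
    intervalIntegral.integral_of_le zero_le_one, integral_Ioc_eq_integral_Ioo] at h
  rw [← h]
  refine integral_congr_ae (.of_forall fun s => ?_)
  simp only [betaWeight, sub_sub_cancel, mul_comm]

/-- Poisson's integral for the Bessel functions. -/
theorem integral_betaWeight_mul_exp {a : ℝ} (ha : 0 < a) (z : ℂ) :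
    ∫ s in Ioo (0 : ℝ) 1, betaWeight a s • Complex.exp (z * (2 * s - 1)) =
      ((2 ^ (1 - 2 * a) * Real.Gamma a * √Real.pi : ℝ) : ℂ) *
        ∑' m : ℕ, (z / 2) ^ (2 * m) / ((m.factorial : ℂ) * Complex.Gamma (a + 1 / 2 + m)) := by
  have hc : Continuous fun s : ℝ => Complex.exp (z * (2 * s - 1)) := by fun_prop
  have hc' : Continuous fun s : ℝ => Complex.exp (z * (2 * ((1 - s : ℝ) : ℂ) - 1)) := by fun_prop
  -- The reflection `s ↦ 1 - s` preserves the weight and negates `2s - 1`, so only the even part of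
  -- the exponential contributes.
  have hcosh : ∫ s in Ioo (0 : ℝ) 1, betaWeight a s • Complex.exp (z * (2 * s - 1)) =
      ∫ s in Ioo (0 : ℝ) 1, betaWeight a s • Complex.cosh (z * (2 * s - 1)) := by
    have hsw := integral_betaWeight_smul_swap a fun s : ℝ => Complex.exp (z * (2 * s - 1))
    have hadd := integral_add (integrableOn_betaWeight_mul ha hc.continuousOn)
      (integrableOn_betaWeight_mul ha hc'.continuousOn)
    rw [hsw, ← two_mul] at hadd
    rw [eq_comm, ← mul_right_inj' (two_ne_zero (α := ℂ)), ← hadd, ← integral_const_mul]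
    refine setIntegral_congr_fun measurableSet_Ioo fun s _ => ?_
    have : z * (2 * ((1 - s : ℝ) : ℂ) - 1) = -(z * (2 * s - 1)) := by push_cast; ring
    simp only [this, Complex.real_smul, Complex.cosh]
    ring
  have hsum : HasSum (fun m : ℕ => ∫ s in Ioo (0 : ℝ) 1,
      betaWeight a s • ((z * (2 * s - 1)) ^ (2 * m) / ((2 * m).factorial : ℂ)))
      (∫ s in Ioo (0 : ℝ) 1, betaWeight a s • Complex.cosh (z * (2 * s - 1))) := by
    have hb := (Real.hasSum_cosh ‖z‖)
    refine hasSum_integral_of_dominated_convergence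
      (fun m s => betaWeight a s * (‖z‖ ^ (2 * m) / ((2 * m).factorial : ℝ))) (fun m => ?_)
      (fun m => ?_) ?_ ?_ ?_
    · exact (integrableOn_betaWeight_mul ha
        (by fun_prop : Continuous fun s : ℝ => (z * (2 * s - 1)) ^ (2 * m) /
          ((2 * m).factorial : ℂ)).continuousOn).aestronglyMeasurable
    · refine (ae_restrict_iff' measurableSet_Ioo).2 (.of_forall fun s hs => ?_)
      rw [norm_smul, Real.norm_of_nonneg (betaWeight_nonneg hs), norm_div, norm_pow, norm_mul,
        Complex.norm_natCast]
      have h1 : ‖(2 * s - 1 : ℂ)‖ ≤ 1 := by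
        rw [show (2 * s - 1 : ℂ) = ((2 * s - 1 : ℝ) : ℂ) by push_cast; rfl, Complex.norm_real,
          Real.norm_eq_abs, abs_le]
        constructor <;> linarith [hs.1, hs.2]
      have h2 : ‖z‖ * ‖(2 * s - 1 : ℂ)‖ ≤ ‖z‖ := mul_le_of_le_one_right (norm_nonneg _) h1
      have := betaWeight_nonneg (a := a) hs
      gcongr
    · exact .of_forall fun s => hb.summable.mul_left _
    · simp_rw [tsum_mul_left, hb.tsum_eq]
      exact (integrableOn_betaWeight ha).mul_const _
    · refine .of_forall fun s => ?_
      exact (Complex.hasSum_cosh _).const_smul _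
  rw [hcosh, ← hsum.tsum_eq, ← tsum_mul_left]
  congr 1 with m
  have hm : ∫ s in Ioo (0 : ℝ) 1,
      betaWeight a s • ((z * (2 * s - 1)) ^ (2 * m) / ((2 * m).factorial : ℂ)) =
      (z ^ (2 * m) / ((2 * m).factorial : ℂ)) *
        ((∫ s in Ioo (0 : ℝ) 1, betaWeight a s * (2 * s - 1) ^ (2 * m) : ℝ) : ℂ) := by
    rw [← integral_complex_ofReal, ← integral_const_mul]
    refine setIntegral_congr_fun measurableSet_Ioo fun s _ => ?_
    simp only [Complex.real_smul, mul_pow]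
    push_cast
    ring
  have h2 : (0 : ℝ) < m + 1 / 2 + a := by positivity
  have hG : Complex.Gamma (a + 1 / 2 + m) = (Real.Gamma (m + 1 / 2 + a) : ℂ) := by
    rw [← Complex.Gamma_ofReal]
    congr 1
    push_cast
    ring
  have hG0 : (Real.Gamma (m + 1 / 2 + a) : ℂ) ≠ 0 := by
    exact_mod_cast (Real.Gamma_pos_of_pos h2).ne'
  have hh : Real.Gamma (m + 1 / 2) = (2 * m).factorial * √Real.pi / (4 ^ m * m.factorial) := by
    rw [eq_div_iff (by positivity), Gamma_nat_add_half_eq]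
  have hf : ((2 * m).factorial : ℂ) ≠ 0 := by exact_mod_cast (Nat.factorial_pos _).ne'
  have hf' : (m.factorial : ℂ) ≠ 0 := by exact_mod_cast (Nat.factorial_pos _).ne'
  rw [hm, integral_betaWeight_mul_pow m ha, hh, hG, div_pow, pow_mul 2 2 m]
  push_cast
  field_simp
  norm_num
  ring

/-! ### Beta means over segments in the right half-plane, and their inversion. -/

/-- The open right half-plane. -/
def rightHalfPlane : Set ℂ := {z | 0 < z.re}

theorem isOpen_rightHalfPlane : IsOpen rightHalfPlane :=
  isOpen_lt continuous_const Complex.continuous_re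

theorem convex_rightHalfPlane : Convex ℝ rightHalfPlane := convex_halfSpace_re_gt 0

theorem inv_mem_rightHalfPlane {z : ℂ} (hz : z ∈ rightHalfPlane) : z⁻¹ ∈ rightHalfPlane := by
  have hz' : 0 < z.re := hz
  have h0 : z ≠ 0 := by rintro rfl; simp at hz'
  show 0 < (z⁻¹).re
  rw [Complex.inv_re]
  exact div_pos hz' (Complex.normSq_pos.2 h0)

theorem mem_slitPlane_of_mem_rightHalfPlane {z : ℂ} (hz : z ∈ rightHalfPlane) :
    z ∈ Complex.slitPlane := Or.inl hz

theorem segment_mem_rightHalfPlane {w w' : ℂ} (hw : w ∈ rightHalfPlane)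
    (hw' : w' ∈ rightHalfPlane) {s : ℝ} (hs : s ∈ Icc (0 : ℝ) 1) :
    (s : ℂ) * w + (1 - s) * w' ∈ rightHalfPlane := by
  have := convex_rightHalfPlane hw hw' hs.1 (sub_nonneg.2 hs.2) (by ring)
  simpa [Complex.real_smul] using this

/-- The mean of `h` over the segment from `w'` to `w`, against the symmetric Beta weight. -/
def betaMean (a : ℝ) (h : ℂ → ℂ) (w w' : ℂ) : ℂ :=
  ∫ s in Ioo (0 : ℝ) 1, betaWeight a s • h (s * w + (1 - s) * w')

theorem betaMean_swap (a : ℝ) (h : ℂ → ℂ) (w w' : ℂ) : betaMean a h w w' = betaMean a h w' w := by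
  rw [betaMean, ← integral_betaWeight_smul_swap, betaMean]
  refine integral_congr_ae (.of_forall fun s => ?_)
  simp only
  congr 2
  push_cast
  ring

theorem continuousOn_comp_segment {h : ℂ → ℂ} (hh : ContinuousOn h rightHalfPlane) {w w' : ℂ}
    (hw : w ∈ rightHalfPlane) (hw' : w' ∈ rightHalfPlane) :
    ContinuousOn (fun s : ℝ => h (s * w + (1 - s) * w')) (Icc 0 1) :=
  hh.comp (by fun_prop) fun _ hs => segment_mem_rightHalfPlane hw hw' hs

/-- Differentiation under the integral sign: as `w` runs over a small closed disc, the segments to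
`w'` sweep out a compact subset of the half-plane, on which `deriv h` is bounded. -/
theorem differentiableOn_betaMean {a : ℝ} (ha : 0 < a) {h : ℂ → ℂ}
    (hh : DifferentiableOn ℂ h rightHalfPlane) {w' : ℂ} (hw' : w' ∈ rightHalfPlane) :
    DifferentiableOn ℂ (fun w => betaMean a h w w') rightHalfPlane := by
  intro w₀ hw₀
  obtain ⟨δ, hδ, hball⟩ := Metric.nhds_basis_closedBall.mem_iff.1
    (isOpen_rightHalfPlane.mem_nhds hw₀)
  have hd := (hh.deriv isOpen_rightHalfPlane).continuousOn
  set K : Set ℂ := (fun p : ℝ × ℂ => (p.1 : ℂ) * p.2 + (1 - p.1) * w') ''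
    (Icc (0 : ℝ) 1 ×ˢ Metric.closedBall w₀ δ) with hK
  have hKc : IsCompact K :=
    (isCompact_Icc.prod (isCompact_closedBall w₀ δ)).image (by fun_prop)
  have hKU : K ⊆ rightHalfPlane := by
    rintro _ ⟨⟨s, w⟩, ⟨hs, hw⟩, rfl⟩
    exact segment_mem_rightHalfPlane (hball hw) hw' hs
  obtain ⟨C, hC⟩ := hKc.exists_bound_of_continuousOn (hd.mono hKU)
  refine (hasDerivAt_integral_of_dominated_loc_of_deriv_le (𝕜 := ℂ)
    (μ := volume.restrict (Ioo (0 : ℝ) 1)) (bound := fun s => betaWeight a s * C)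
    (F := fun w s => betaWeight a s • h (s * w + (1 - s) * w'))
    (F' := fun w s => betaWeight a s • (deriv h (s * w + (1 - s) * w') * s))
    (Metric.closedBall_mem_nhds w₀ hδ) ?_ ?_ ?_ ?_ ?_ ?_).2.differentiableAt.differentiableWithinAt
  · filter_upwards [isOpen_rightHalfPlane.mem_nhds hw₀] with w hw
    exact (integrableOn_betaWeight_mul ha
      (continuousOn_comp_segment hh.continuousOn hw hw')).aestronglyMeasurable
  · exact integrableOn_betaWeight_mul ha (continuousOn_comp_segment hh.continuousOn hw₀ hw')
  · exact (integrableOn_betaWeight_mul ha ((continuousOn_comp_segment hd hw₀ hw').mul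
      (by fun_prop))).aestronglyMeasurable
  · refine (ae_restrict_iff' measurableSet_Ioo).2 (.of_forall fun s hs w hw => ?_)
    rw [norm_smul, Real.norm_of_nonneg (betaWeight_nonneg hs), norm_mul, Complex.norm_real,
      Real.norm_of_nonneg hs.1.le]
    have h1 := hC _ ⟨(s, w), ⟨Ioo_subset_Icc_self hs, hw⟩, rfl⟩
    have h2 := mul_le_mul h1 hs.2.le hs.1.le ((norm_nonneg _).trans h1)
    rw [mul_one] at h2
    exact mul_le_mul_of_nonneg_left h2 (betaWeight_nonneg hs)
  · exact (integrableOn_betaWeight ha).mul_const C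
  · refine (ae_restrict_iff' measurableSet_Ioo).2 (.of_forall fun s hs w hw => ?_)
    have hmem := segment_mem_rightHalfPlane (hball hw) hw' (Ioo_subset_Icc_self hs)
    have h1 := (hh.differentiableAt (isOpen_rightHalfPlane.mem_nhds hmem)).hasDerivAt
    have h2 : HasDerivAt (fun w : ℂ => (s : ℂ) * w + (1 - s) * w') (s : ℂ) w := by
      simpa using ((hasDerivAt_id w).const_mul (s : ℂ)).add_const ((1 - s) * w')
    exact (h1.comp w h2).const_smul (betaWeight a s)

theorem eqOn_rightHalfPlane_of_eq_ofReal {f g : ℂ → ℂ} (hf : DifferentiableOn ℂ f rightHalfPlane)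
    (hg : DifferentiableOn ℂ g rightHalfPlane) (h : ∀ p : ℝ, 0 < p → f p = g p) :
    EqOn f g rightHalfPlane := by
  have h1 : (1 : ℂ) ∈ rightHalfPlane := by simp [rightHalfPlane]
  refine (hf.analyticOnNhd isOpen_rightHalfPlane).eqOn_of_preconnected_of_frequently_eq
    (hg.analyticOnNhd isOpen_rightHalfPlane) convex_rightHalfPlane.isPreconnected h1 ?_
  have ht : Filter.Tendsto (fun p : ℝ => (p : ℂ)) (nhdsWithin 1 {1}ᶜ) (nhdsWithin 1 {1}ᶜ) := by
    refine tendsto_nhdsWithin_iff.2 ⟨?_, ?_⟩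
    · exact (Complex.continuous_ofReal.tendsto' 1 1 (by simp)).mono_left nhdsWithin_le_nhds
    · filter_upwards [self_mem_nhdsWithin] with p hp
      simpa using hp
  refine ht.frequently (Filter.Eventually.frequently ?_)
  filter_upwards [nhdsWithin_le_nhds (lt_mem_nhds one_pos)] with p hp using h p hp

/-- The substitution `t = s p / (s p + (1 - s) q)`. -/
theorem betaMean_ofReal_inv (a : ℝ) (h : ℂ → ℂ) {p q : ℝ} (hp : 0 < p) (hq : 0 < q) :
    betaMean a (fun τ => τ ^ (-(2 * a : ℂ)) * h τ⁻¹) p q =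
      (p : ℂ) ^ (-(a : ℂ)) * (q : ℂ) ^ (-(a : ℂ)) * betaMean a h (p : ℂ)⁻¹ (q : ℂ)⁻¹ := by
  have hpos : ∀ {p q s : ℝ}, 0 < p → 0 < q → s ∈ Ioo (0 : ℝ) 1 → 0 < s * p + (1 - s) * q :=
    fun hp hq hs => add_pos (mul_pos hs.1 hp) (mul_pos (sub_pos.2 hs.2) hq)
  -- Chosen so that `f s / p + (1 - f s) / q = 1 / (s p + (1 - s) q)`: it carries the parameter of a
  -- point on one segment to that of its inverse on the other. Its inverse map is the same formula
  -- with `p` and `q` exchanged.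
  set f : ℝ → ℝ := fun s => s * p / (s * p + (1 - s) * q) with hf
  have hmaps : ∀ s ∈ Ioo (0 : ℝ) 1, f s ∈ Ioo (0 : ℝ) 1 := fun s hs => by
    refine ⟨div_pos (mul_pos hs.1 hp) (hpos hp hq hs), (div_lt_one (hpos hp hq hs)).2 ?_⟩
    nlinarith [mul_pos (sub_pos.2 hs.2) hq]
  have himage : f '' Ioo 0 1 = Ioo 0 1 := by
    refine Subset.antisymm (by rintro _ ⟨s, hs, rfl⟩; exact hmaps s hs) fun t ht => ?_
    have h1 := hpos hq hp ht
    refine ⟨t * q / (t * q + (1 - t) * p), ⟨div_pos (mul_pos ht.1 hq) h1,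
      (div_lt_one h1).2 (by nlinarith [mul_pos (sub_pos.2 ht.2) hp])⟩, ?_⟩
    have h2 : t * q / (t * q + (1 - t) * p) * p + (1 - t * q / (t * q + (1 - t) * p)) * q =
        p * q / (t * q + (1 - t) * p) := by
      field_simp
      ring
    simp only [hf]
    rw [h2]
    field_simp
  have hderiv : ∀ s ∈ Ioo (0 : ℝ) 1,
      HasDerivWithinAt f (p * q / (s * p + (1 - s) * q) ^ 2) (Ioo 0 1) s := fun s hs => by
    have h1 : HasDerivAt (fun s : ℝ => s * p) p s := by
      simpa using (hasDerivAt_id s).mul_const p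
    have h2 : HasDerivAt (fun s : ℝ => s * p + (1 - s) * q) (p - q) s := by
      refine (h1.add (((hasDerivAt_id s).const_sub 1).mul_const q)).congr_deriv ?_
      ring
    refine ((h1.div h2 (hpos hp hq hs).ne').congr_deriv ?_).hasDerivWithinAt
    congr 1
    ring
  have hinj : InjOn f (Ioo 0 1) := fun s hs t ht hst => by
    simp only [hf] at hst
    rw [div_eq_div_iff (hpos hp hq hs).ne' (hpos hp hq ht).ne'] at hst
    have : (s - t) * (p * q) = 0 := by linear_combination hst
    rcases mul_eq_zero.1 this with h0 | h0
    · linarith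
    · exact absurd h0 (mul_pos hp hq).ne'
  have hsub := integral_image_eq_integral_abs_deriv_smul measurableSet_Ioo hderiv hinj
    (fun t : ℝ => betaWeight a t • h (t * (p : ℂ)⁻¹ + (1 - t) * (q : ℂ)⁻¹))
  rw [himage] at hsub
  rw [betaMean, betaMean, hsub, ← integral_const_mul]
  refine setIntegral_congr_fun measurableSet_Ioo fun s hs => ?_
  have hτ := hpos hp hq hs
  have hw := mul_pos hs.1 (sub_pos.2 hs.2)
  have harg : (f s : ℂ) * (p : ℂ)⁻¹ + (1 - f s) * (q : ℂ)⁻¹ =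
      ((s : ℂ) * p + (1 - s) * q)⁻¹ := by
    have : f s * p⁻¹ + (1 - f s) * q⁻¹ = (s * p + (1 - s) * q)⁻¹ := by
      simp only [hf]
      field_simp
      ring
    exact_mod_cast this
  -- Because `f (1 - f) = s (1 - s) f'`, the weight times the Jacobian is the old weight times `f' ^
  -- a`, and `f' = p q / τ²` yields exactly the automorphy factor of weight `2a`.
  have hweight : betaWeight a (f s) * (p * q / (s * p + (1 - s) * q) ^ 2) =
      betaWeight a s * ((p * q) ^ a * (s * p + (1 - s) * q) ^ (-(2 * a))) := by
    have h1 : f s * (1 - f s) = s * (1 - s) * (p * q / (s * p + (1 - s) * q) ^ 2) := by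
      simp only [hf]
      field_simp
      ring
    have hX : 0 < p * q / (s * p + (1 - s) * q) ^ 2 := by positivity
    rw [betaWeight, h1, Real.mul_rpow hw.le hX.le, mul_assoc, ← Real.rpow_add_one hX.ne',
      sub_add_cancel, Real.div_rpow (by positivity) (by positivity), ← Real.rpow_natCast_mul hτ.le,
      Real.rpow_neg hτ.le, betaWeight]
    push_cast
    rfl
  have hcast : ((s : ℂ) * p + (1 - s) * q) ^ (-(2 * a : ℂ)) =
      (((s * p + (1 - s) * q) ^ (-(2 * a)) : ℝ) : ℂ) := by
    rw [Complex.ofReal_cpow hτ.le]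
    push_cast
    rfl
  have hpq : (p : ℂ) ^ (-(a : ℂ)) * (q : ℂ) ^ (-(a : ℂ)) = (((p * q) ^ (-a) : ℝ) : ℂ) := by
    rw [Real.mul_rpow hp.le hq.le, Complex.ofReal_mul, Complex.ofReal_cpow hp.le,
      Complex.ofReal_cpow hq.le]
    push_cast
    rfl
  rw [harg, hcast, hpq, abs_of_nonneg (by positivity), smul_smul, mul_comm (_ / _), hweight]
  simp only [Complex.real_smul]
  have hone : (((p * q) ^ (-a) : ℝ) : ℂ) * (((p * q) ^ a : ℝ) : ℂ) = 1 := by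
    rw [← Complex.ofReal_mul, ← Real.rpow_add (by positivity)]
    simp
  push_cast
  linear_combination (-(betaWeight a s : ℂ) * (((s * p + (1 - s) * q) ^ (-(2 * a)) : ℝ) : ℂ) *
    h ((s : ℂ) * p + (1 - s) * q)⁻¹) * hone

/-- A holomorphic function on the right half-plane that transforms like a modular form of weight
`2 a` under `τ ↦ 1 / τ` has Beta means that transform with weight `a` in each variable. -/
theorem betaMean_inv {a : ℝ} (ha : 0 < a) {h : ℂ → ℂ}
    (hh : DifferentiableOn ℂ h rightHalfPlane)
    (hinv : ∀ τ ∈ rightHalfPlane, h τ = τ ^ (-(2 * a : ℂ)) * h τ⁻¹)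
    {w w' : ℂ} (hw : w ∈ rightHalfPlane) (hw' : w' ∈ rightHalfPlane) :
    betaMean a h w w' = w ^ (-(a : ℂ)) * w' ^ (-(a : ℂ)) * betaMean a h w⁻¹ w'⁻¹ := by
  have hdiffr : ∀ {v : ℂ}, v ∈ rightHalfPlane → DifferentiableOn ℂ
      (fun w => w ^ (-(a : ℂ)) * v ^ (-(a : ℂ)) * betaMean a h w⁻¹ v⁻¹) rightHalfPlane := by
    intro v hv
    refine DifferentiableOn.mul (DifferentiableOn.mul_const ?_ _) ?_
    · exact fun z hz => (differentiableAt_id.cpow_const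
        (mem_slitPlane_of_mem_rightHalfPlane hz)).differentiableWithinAt
    · refine (differentiableOn_betaMean ha hh (inv_mem_rightHalfPlane hv)).comp
        (differentiableOn_id.inv fun z hz h0 => ?_) fun z hz => inv_mem_rightHalfPlane hz
      exact Complex.slitPlane_ne_zero (mem_slitPlane_of_mem_rightHalfPlane hz) h0
  have hreal : ∀ p q : ℝ, 0 < p → 0 < q → betaMean a h p q =
      (p : ℂ) ^ (-(a : ℂ)) * (q : ℂ) ^ (-(a : ℂ)) * betaMean a h (p : ℂ)⁻¹ (q : ℂ)⁻¹ := by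
    intro p q hp hq
    rw [← betaMean_ofReal_inv a h hp hq, betaMean, betaMean]
    refine setIntegral_congr_fun measurableSet_Ioo fun s hs => ?_
    have := hinv _ (segment_mem_rightHalfPlane (w := p) (w' := q) (by simpa [rightHalfPlane])
      (by simpa [rightHalfPlane]) (Ioo_subset_Icc_self hs))
    rw [this]
  -- Analytic continuation in the first endpoint with the second real; the final step then fixes the
  -- complex first endpoint and continues in the second, the symmetry `betaMean_swap` exchanging
  -- their roles.
  have hleft : ∀ q : ℝ, 0 < q → ∀ w ∈ rightHalfPlane, betaMean a h w q =
      w ^ (-(a : ℂ)) * (q : ℂ) ^ (-(a : ℂ)) * betaMean a h w⁻¹ (q : ℂ)⁻¹ := fun q hq =>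
    have hq' : (q : ℂ) ∈ rightHalfPlane := by simpa [rightHalfPlane]
    eqOn_rightHalfPlane_of_eq_ofReal (differentiableOn_betaMean ha hh hq') (hdiffr hq')
      fun p hp => hreal p q hp hq
  have := eqOn_rightHalfPlane_of_eq_ofReal (differentiableOn_betaMean ha hh hw) (hdiffr hw)
    (fun q hq => by
      rw [betaMean_swap, hleft q hq w hw, betaMean_swap, mul_comm (w ^ _)]) hw'
  simp only at this
  rw [betaMean_swap, this, betaMean_swap, mul_comm (w ^ _)]

/-! ### Powers of the theta series and representations as sums of squares. -/

theorem hasSum_prod_fin_pow {ι : Type*} {f : ι → ℂ} (hf : Summable fun i => ‖f i‖) (k : ℕ) :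
    (Summable fun v : Fin k → ι => ‖∏ i, f (v i)‖) ∧
      HasSum (fun v : Fin k → ι => ∏ i, f (v i)) ((∑' i, f i) ^ k) := by
  induction k with
  | zero =>
    refine ⟨(hasSum_fintype _).summable, ?_⟩
    simp
  | succ k ih =>
    have hn := hf.mul_norm ih.1
    have hs := summable_mul_of_summable_norm hf ih.1
    have ht := tsum_mul_tsum_of_summable_norm hf ih.1
    have hcomp : ∀ p : ι × (Fin k → ι),
        ∏ i, f (Fin.consEquiv (fun _ => ι) p i) = f p.1 * ∏ i, f (p.2 i) := fun p => by
      simp [Fin.prod_univ_succ, Fin.consEquiv]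
    constructor
    · rw [← (Fin.consEquiv fun _ => ι).summable_iff]
      simpa only [Function.comp_def, hcomp] using hn
    · rw [← (Fin.consEquiv fun _ => ι).hasSum_iff]
      simp only [Function.comp_def, hcomp]
      rw [pow_succ', ← ih.2.tsum_eq, ht]
      exact hs.hasSum

/-- The theta series `∑ exp (-π m² τ)` on the right half-plane. -/
def sqTheta (τ : ℂ) : ℂ := jacobiTheta (Complex.I * τ)

theorem sqTheta_term (τ : ℂ) (m : ℤ) :
    Complex.exp (Real.pi * Complex.I * (m : ℂ) ^ 2 * (Complex.I * τ)) =
      Complex.exp (-(Real.pi * (m : ℂ) ^ 2 * τ)) := by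
  congr 1
  linear_combination (Real.pi * (m : ℂ) ^ 2 * τ) * Complex.I_mul_I

theorem sqTheta_eq_tsum (τ : ℂ) :
    sqTheta τ = ∑' m : ℤ, Complex.exp (-(Real.pi * (m : ℂ) ^ 2 * τ)) :=
  tsum_congr (sqTheta_term τ)

theorem I_mul_im_pos {τ : ℂ} (hτ : τ ∈ rightHalfPlane) : 0 < (Complex.I * τ).im := by
  simpa [rightHalfPlane] using hτ

theorem summable_norm_sqTheta {τ : ℂ} (hτ : τ ∈ rightHalfPlane) :
    Summable fun m : ℤ => ‖Complex.exp (-(Real.pi * (m : ℂ) ^ 2 * τ))‖ := by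
  have h := (hasSum_jacobiTheta₂_term 0 (I_mul_im_pos hτ)).summable.norm
  refine h.congr fun m => ?_
  rw [← sqTheta_term]
  simp [jacobiTheta₂_term]

theorem differentiableOn_sqTheta : DifferentiableOn ℂ sqTheta rightHalfPlane := fun τ hτ =>
  ((differentiableAt_jacobiTheta (I_mul_im_pos hτ)).comp τ
    (differentiableAt_id.const_mul Complex.I)).differentiableWithinAt

theorem sqTheta_inv {τ : ℂ} (hτ : τ ∈ rightHalfPlane) :
    sqTheta τ = τ ^ (-(1 / 2 : ℂ)) * sqTheta τ⁻¹ := by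
  have h := Complex.tsum_exp_neg_mul_int_sq (a := τ) hτ
  have e : ∀ σ : ℂ, sqTheta σ = ∑' m : ℤ, Complex.exp (-Real.pi * σ * (m : ℂ) ^ 2) := fun σ => by
    rw [sqTheta_eq_tsum]
    exact tsum_congr fun m => by ring_nf
  rw [e, e, h, Complex.cpow_neg, ← one_div, div_eq_mul_inv (-(Real.pi : ℂ))]

theorem sqTheta_pow_inv (k : ℕ) {τ : ℂ} (hτ : τ ∈ rightHalfPlane) :
    sqTheta τ ^ k = τ ^ (-(2 * ((k / 4 : ℝ) : ℂ))) * sqTheta τ⁻¹ ^ k := by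
  rw [sqTheta_inv hτ, mul_pow, ← Complex.cpow_nat_mul]
  congr 2
  push_cast
  ring

/-- The `k`-th power is an absolutely convergent sum over `ℤ^k`; grouping vectors by the value of `∑
v i ^ 2` gives fibres with `r_k(n)` elements, on which the summand is constant. -/
theorem hasSum_sumSqReps (k : ℕ) {τ : ℂ} (hτ : τ ∈ rightHalfPlane) :
    (Summable fun n : ℕ => ‖(sumSqReps k n : ℂ) * Complex.exp (-(Real.pi * n * τ))‖) ∧
    HasSum (fun n : ℕ => (sumSqReps k n : ℂ) * Complex.exp (-(Real.pi * n * τ)))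
      (sqTheta τ ^ k) := by
  obtain ⟨h1, h2⟩ := hasSum_prod_fin_pow (summable_norm_sqTheta hτ) k
  rw [← sqTheta_eq_tsum] at h2
  set g : (Fin k → ℤ) → ℕ := fun v => (∑ i, v i ^ 2).toNat with hg
  have hfib : ∀ n : ℕ, g ⁻¹' {n} = {v : Fin k → ℤ | ∑ i, v i ^ 2 = (n : ℤ)} := fun n => by
    ext v
    have : 0 ≤ ∑ i, v i ^ 2 := Finset.sum_nonneg fun _ _ => sq_nonneg _
    simp only [hg, mem_preimage, mem_singleton_iff, mem_ofPred_eq]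
    omega
  have hterm : ∀ n : ℕ, ∀ v ∈ g ⁻¹' {n},
      ∏ i, Complex.exp (-(Real.pi * (v i : ℂ) ^ 2 * τ)) = Complex.exp (-(Real.pi * n * τ)) := by
    intro n v hv
    rw [hfib] at hv
    have hv' : ∑ i, (v i : ℂ) ^ 2 = (n : ℂ) := by exact_mod_cast congrArg (Int.cast (R := ℂ)) hv
    rw [← Complex.exp_sum, Finset.sum_neg_distrib, ← Finset.sum_mul, ← Finset.mul_sum, hv']
  have hcard : ∀ n : ℕ, Nat.card (g ⁻¹' {n}) = sumSqReps k n := fun n => by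
    rw [hfib, sumSqReps, Nat.card_coe_set_eq]
  constructor
  · refine (h1.hasSum.tsum_fiberwise g).summable.congr fun n => ?_
    have : ∀ v : g ⁻¹' {n}, ‖∏ i, Complex.exp (-(Real.pi * ((v : Fin k → ℤ) i : ℂ) ^ 2 * τ))‖ =
        ‖Complex.exp (-(Real.pi * n * τ))‖ := fun v => by rw [hterm n v v.2]
    rw [tsum_congr this, tsum_const, hcard, norm_mul, Complex.norm_natCast, nsmul_eq_mul]
  · refine (h2.tsum_fiberwise g).congr_fun fun n => ?_
    have : ∀ v : g ⁻¹' {n}, ∏ i, Complex.exp (-(Real.pi * ((v : Fin k → ℤ) i : ℂ) ^ 2 * τ)) =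
        Complex.exp (-(Real.pi * n * τ)) := fun v => hterm n v v.2
    rw [tsum_congr this, tsum_const, hcard, nsmul_eq_mul]

theorem sumSqReps_zero (k : ℕ) : sumSqReps k 0 = 1 := by
  rw [sumSqReps, Set.ncard_eq_one]
  refine ⟨0, ?_⟩
  ext v
  simp only [mem_ofPred_eq, mem_singleton_iff, Nat.cast_zero]
  rw [Finset.sum_eq_zero_iff_of_nonneg fun _ _ => sq_nonneg _]
  simp [funext_iff]

/-! ### The theta expansion averaged term by term. -/

/-- The mean of `exp (-π n τ)` over the segment from `w'` to `w`. -/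
def betaMeanExp (k n : ℕ) (w w' : ℂ) : ℂ :=
  betaMean (k / 4) (fun τ => Complex.exp (-(Real.pi * n * τ))) w w'

theorem hasSum_betaMeanExp {k : ℕ} (hk : 1 ≤ k) {w w' : ℂ} (hw : w ∈ rightHalfPlane)
    (hw' : w' ∈ rightHalfPlane) :
    HasSum (fun n : ℕ => (sumSqReps k n : ℂ) * betaMeanExp k n w w')
      (betaMean (k / 4) (fun τ => sqTheta τ ^ k) w w') := by
  have ha : (0 : ℝ) < k / 4 := by positivity
  -- Every point of the segment has real part at least `t`, so the absolutely convergent expansion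
  -- at `t` dominates the one at each point.
  set t : ℝ := min w.re w'.re with ht
  have ht0 : (t : ℂ) ∈ rightHalfPlane := by simpa [rightHalfPlane, ht] using ⟨hw, hw'⟩
  have hb := (hasSum_sumSqReps k ht0).1
  have hF : ∀ n : ℕ, (sumSqReps k n : ℂ) * betaMeanExp k n w w' =
      ∫ s in Ioo (0 : ℝ) 1, betaWeight (k / 4) s •
        ((sumSqReps k n : ℂ) * Complex.exp (-(Real.pi * n * (s * w + (1 - s) * w')))) := fun n => by
    rw [betaMeanExp, betaMean, ← integral_const_mul]
    simp only [mul_smul_comm]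
  simp_rw [hF]
  refine hasSum_integral_of_dominated_convergence
    (fun n s => betaWeight (k / 4) s *
      ‖(sumSqReps k n : ℂ) * Complex.exp (-(Real.pi * n * (t : ℂ)))‖)
    (fun n => ?_) (fun n => ?_) ?_ ?_ ?_
  · exact (integrableOn_betaWeight_mul ha (by fun_prop : Continuous fun s : ℝ =>
      (sumSqReps k n : ℂ) * Complex.exp (-(Real.pi * n * (s * w + (1 - s) * w')))
      ).continuousOn).aestronglyMeasurable
  · refine (ae_restrict_iff' measurableSet_Ioo).2 (.of_forall fun s hs => ?_)
    rw [norm_smul, Real.norm_of_nonneg (betaWeight_nonneg hs), norm_mul, norm_mul]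
    refine mul_le_mul_of_nonneg_left (mul_le_mul_of_nonneg_left ?_ (norm_nonneg _))
      (betaWeight_nonneg hs)
    rw [Complex.norm_exp, Complex.norm_exp, Real.exp_le_exp]
    have hre : t ≤ s * w.re + (1 - s) * w'.re := by
      have h1 := mul_le_mul_of_nonneg_left (min_le_left w.re w'.re) hs.1.le
      have h2 := mul_le_mul_of_nonneg_left (min_le_right w.re w'.re) (sub_pos.2 hs.2).le
      linear_combination h1 + h2
    have e1 : (-(Real.pi * n * (s * w + (1 - s) * w')) : ℂ).re =
        -(Real.pi * n * (s * w.re + (1 - s) * w'.re)) := by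
      simp [Complex.mul_re]
    have e2 : (-(Real.pi * n * (t : ℂ)) : ℂ).re = -(Real.pi * n * t) := by
      simp [Complex.mul_re]
    rw [e1, e2]
    exact neg_le_neg (mul_le_mul_of_nonneg_left hre (by positivity))
  · exact .of_forall fun s => hb.mul_left _
  · simp_rw [tsum_mul_left]
    exact (integrableOn_betaWeight ha).mul_const _
  · refine (ae_restrict_iff' measurableSet_Ioo).2 (.of_forall fun s hs => ?_)
    exact (hasSum_sumSqReps k (segment_mem_rightHalfPlane hw hw'
      (Ioo_subset_Icc_self hs))).2.const_smul _

theorem hasSum_pnat_betaMeanExp {k : ℕ} (hk : 1 ≤ k) {w w' : ℂ} (hw : w ∈ rightHalfPlane)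
    (hw' : w' ∈ rightHalfPlane) :
    HasSum (fun n : ℕ+ => (sumSqReps k n : ℂ) * betaMeanExp k n w w')
      (betaMean (k / 4) (fun τ => sqTheta τ ^ k) w w' - betaMeanExp k 0 w w') := by
  have h := hasSum_betaMeanExp hk hw hw'
  rw [← hasSum_nat_add_iff' 1] at h
  simp only [Finset.sum_range_one, sumSqReps_zero, Nat.cast_one, one_mul] at h
  rw [← Equiv.pnatEquivNat.symm.hasSum_iff]
  exact h.congr_fun fun n => by simp

/-! ### Branches of the powers, and the Bessel terms as Beta means. -/

theorem powAt_ofReal_mul {r : ℝ} (hr : 0 ≤ r) (z : ℂ) (θ : ℝ) (ν : ℂ) :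
    powAt (r * z) θ ν = (r : ℂ) ^ ν * powAt z θ ν := by
  rw [powAt, powAt, norm_mul, Complex.norm_real, Real.norm_of_nonneg hr, Complex.ofReal_mul,
    Complex.mul_cpow_ofReal_nonneg hr (norm_nonneg z), mul_assoc]

/-- The reason for the determination `θ - Arg D` on the right-hand side: with it, dividing by `D`
costs exactly the principal power of `D`, without a further branch factor. -/
theorem powAt_div (y : ℂ) {D : ℂ} (hD : D ≠ 0) (θ : ℝ) (ν : ℂ) :
    powAt (y / D) (θ - D.arg) ν = powAt y θ ν / D ^ ν := by
  have h0 : (‖D‖ : ℂ) ^ ν ≠ 0 := by simp [Complex.cpow_eq_zero_iff, hD]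
  have hy : (‖y‖ : ℂ) ^ ν = (‖y / D‖ : ℂ) ^ ν * (‖D‖ : ℂ) ^ ν := by
    rw [← Complex.mul_cpow_ofReal_nonneg (norm_nonneg _) (norm_nonneg _), ← Complex.ofReal_mul,
      ← norm_mul, div_mul_cancel₀ _ hD]
  rw [← powAt_arg, powAt, powAt, powAt, eq_div_iff (mul_ne_zero h0 (Complex.exp_ne_zero _)), hy]
  have he : Complex.exp (ν * (((θ - D.arg : ℝ) : ℂ) * Complex.I)) *
      Complex.exp (ν * (D.arg * Complex.I)) = Complex.exp (ν * (θ * Complex.I)) := by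
    rw [← Complex.exp_add]
    congr 1
    push_cast
    ring
  linear_combination ((‖y / D‖ : ℂ) ^ ν * (‖D‖ : ℂ) ^ ν) * he

/-- The ratio of the Bessel terms to the Beta means of the exponentials. -/
def besselFactor (k : ℕ) (Y : ℂ) (θ : ℝ) : ℂ :=
  ((Real.pi / 2 : ℝ) : ℂ) ^ ((k : ℂ) / 4 - 1 / 2) * powAt Y θ ((k : ℂ) / 4 - 1 / 2) /
    ((2 ^ (1 - 2 * (k / 4 : ℝ)) * Real.Gamma (k / 4) * √Real.pi : ℝ) : ℂ)

theorem besselFactor_div (k : ℕ) (Y : ℂ) {D : ℂ} (hD : D ≠ 0) (θ : ℝ) :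
    besselFactor k (Y / D) (θ - D.arg) = besselFactor k Y θ / D ^ ((k : ℂ) / 4 - 1 / 2) := by
  rw [besselFactor, besselFactor, powAt_div Y hD]
  ring

theorem betaConst_ne_zero {k : ℕ} (hk : 1 ≤ k) :
    ((2 ^ (1 - 2 * (k / 4 : ℝ)) * Real.Gamma (k / 4) * √Real.pi : ℝ) : ℂ) ≠ 0 := by
  have ha : (0 : ℝ) < k / 4 := by positivity
  have := Real.Gamma_pos_of_pos ha
  exact_mod_cast (by positivity : 0 < 2 ^ (1 - 2 * (k / 4 : ℝ)) * Real.Gamma (k / 4) * √Real.pi).ne'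

/-- The points of the segment are `X + (2s - 1) V`; the factor at the centre `X` comes out and
Poisson's integral evaluates the rest. -/
theorem betaMeanExp_eq {k : ℕ} (hk : 1 ≤ k) (n : ℕ) (X V : ℂ) :
    betaMeanExp k n (X + V) (X - V) = Complex.exp (-(Real.pi * n * X)) *
      (((2 ^ (1 - 2 * (k / 4 : ℝ)) * Real.Gamma (k / 4) * √Real.pi : ℝ) : ℂ) *
        ∑' m : ℕ, (Real.pi * n * V / 2) ^ (2 * m) /
          ((m.factorial : ℂ) * Complex.Gamma ((k : ℂ) / 4 - 1 / 2 + m + 1))) := by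
  have ha : (0 : ℝ) < k / 4 := by positivity
  have h := integral_betaWeight_mul_exp ha (-(Real.pi * n * V))
  have hsum : ∑' m : ℕ, (-(Real.pi * n * V) / 2) ^ (2 * m) /
      ((m.factorial : ℂ) * Complex.Gamma (((k / 4 : ℝ) : ℂ) + 1 / 2 + m)) =
      ∑' m : ℕ, (Real.pi * n * V / 2) ^ (2 * m) /
        ((m.factorial : ℂ) * Complex.Gamma ((k : ℂ) / 4 - 1 / 2 + m + 1)) := by
    refine tsum_congr fun m => ?_
    rw [neg_div, Even.neg_pow (even_two_mul m),
      show ((k / 4 : ℝ) : ℂ) + 1 / 2 + m = (k : ℂ) / 4 - 1 / 2 + m + 1 by push_cast; ring]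
  rw [← hsum, ← h, betaMeanExp, betaMean, ← integral_const_mul]
  refine setIntegral_congr_fun measurableSet_Ioo fun s _ => ?_
  simp only [mul_smul_comm, ← Complex.exp_add]
  congr 2
  ring

theorem betaMeanExp_zero {k : ℕ} (hk : 1 ≤ k) (w w' : ℂ) :
    betaMeanExp k 0 w w' =
      ((2 ^ (1 - 2 * (k / 4 : ℝ)) * Real.Gamma (k / 4) * √Real.pi : ℝ) : ℂ) /
        Complex.Gamma ((k : ℂ) / 4 + 1 / 2) := by
  -- For `n = 0` the averaged function is constant, so the endpoints may be replaced by any others;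
  -- those chosen have the shape `X ± V`.
  have h : betaMeanExp k 0 w w' = betaMeanExp k 0 (0 + 0) (0 - 0) := by simp [betaMeanExp, betaMean]
  rw [h, betaMeanExp_eq hk, tsum_eq_single 0 fun m hm => by simp [hm]]
  rw [show (k : ℂ) / 4 - 1 / 2 + ((0 : ℕ) : ℂ) + 1 = (k : ℂ) / 4 + 1 / 2 by push_cast; ring]
  simp [div_eq_mul_inv]

theorem thetaConst_eq {k : ℕ} (hk : 1 ≤ k) (Y : ℂ) (θ : ℝ) (w w' : ℂ) :
    thetaConst k Y θ = besselFactor k Y θ * betaMeanExp k 0 w w' := by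
  have hC := betaConst_ne_zero hk
  have h2 : ((Real.pi : ℝ) : ℂ) ^ ((k : ℂ) / 4 - 1 / 2) =
      ((Real.pi / 2 : ℝ) : ℂ) ^ ((k : ℂ) / 4 - 1 / 2) * (2 : ℂ) ^ ((k : ℂ) / 4 - 1 / 2) := by
    rw [show (2 : ℂ) = ((2 : ℝ) : ℂ) by norm_num,
      ← Complex.mul_cpow_ofReal_nonneg (by positivity) zero_le_two]
    push_cast
    ring_nf
  have h0 : (2 : ℂ) ^ ((k : ℂ) / 4 - 1 / 2) ≠ 0 := by simp [Complex.cpow_eq_zero_iff]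
  rw [betaMeanExp_zero hk, besselFactor, thetaConst, powAt_ofReal_mul Real.pi_pos.le, h2]
  generalize ((2 ^ (1 - 2 * (k / 4 : ℝ)) * Real.Gamma (k / 4) * √Real.pi : ℝ) : ℂ) = C at *
  field_simp

/-- The parameters `Y` and `V` are kept apart because the branched power involves `Y` while the even
series involves `V`: `V = Y` gives `I_ν`, and `V = i Y` produces the alternating signs of `J_ν`. The
`n^ν` from the branched power cancels the denominator. -/
theorem besselTerm_eq {k : ℕ} (hk : 1 ≤ k) (X Y V : ℂ) (θ : ℝ) (n : ℕ+) :
    (sumSqReps k n : ℂ) / ((n : ℕ) : ℂ) ^ ((k : ℂ) / 4 - 1 / 2) *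
      Complex.exp (-(Real.pi * (n : ℕ) * X)) *
      (powAt (Real.pi * (n : ℕ) * Y / 2) θ ((k : ℂ) / 4 - 1 / 2) *
        ∑' m : ℕ, (Real.pi * (n : ℕ) * V / 2) ^ (2 * m) /
          ((m.factorial : ℂ) * Complex.Gamma ((k : ℂ) / 4 - 1 / 2 + m + 1))) =
      besselFactor k Y θ * ((sumSqReps k n : ℂ) * betaMeanExp k n (X + V) (X - V)) := by
  have hn : ((n : ℕ) : ℂ) ≠ 0 := by simp
  have h0 : ((n : ℕ) : ℂ) ^ ((k : ℂ) / 4 - 1 / 2) ≠ 0 := by simp [Complex.cpow_eq_zero_iff]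
  have hC := betaConst_ne_zero hk
  have hp : powAt (Real.pi * (n : ℕ) * Y / 2) θ ((k : ℂ) / 4 - 1 / 2) =
      ((n : ℕ) : ℂ) ^ ((k : ℂ) / 4 - 1 / 2) * (((Real.pi / 2 : ℝ) : ℂ) ^ ((k : ℂ) / 4 - 1 / 2) *
        powAt Y θ ((k : ℂ) / 4 - 1 / 2)) := by
    rw [← powAt_ofReal_mul (by positivity), ← Complex.ofReal_natCast,
      ← powAt_ofReal_mul (by positivity)]
    congr 1
    push_cast
    ring
  rw [betaMeanExp_eq hk, hp, besselFactor]
  generalize ((2 ^ (1 - 2 * (k / 4 : ℝ)) * Real.Gamma (k / 4) * √Real.pi : ℝ) : ℂ) = C at *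
  field_simp

theorem thetaITerm_eq {k : ℕ} (hk : 1 ≤ k) (X Y : ℂ) (θ : ℝ) (n : ℕ+) :
    thetaITerm k X Y θ n =
      besselFactor k Y θ * ((sumSqReps k n : ℂ) * betaMeanExp k n (X + Y) (X - Y)) :=
  besselTerm_eq hk X Y Y θ n

theorem thetaJTerm_eq {k : ℕ} (hk : 1 ≤ k) (X Y : ℂ) (θ : ℝ) (n : ℕ+) :
    thetaJTerm k X Y θ n = besselFactor k Y θ *
      ((sumSqReps k n : ℂ) * betaMeanExp k n (X + Complex.I * Y) (X - Complex.I * Y)) := by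
  rw [← besselTerm_eq hk, thetaJTerm, besselJAt]
  congr 3 with m
  rw [show (Real.pi * (n : ℕ) * (Complex.I * Y) / 2 : ℂ) =
    Complex.I * (Real.pi * (n : ℕ) * Y / 2) by ring, mul_pow, pow_mul Complex.I, Complex.I_sq]

/-! ### The transformation formula. -/

/-- Both arguments lie in `(-π/2, π/2)`, so their sum stays within the principal range. This is what
makes the principal powers of `D = w w'` the correct ones. -/
theorem mul_cpow_of_mem_rightHalfPlane {w w' : ℂ} (hw : w ∈ rightHalfPlane)
    (hw' : w' ∈ rightHalfPlane) (c : ℂ) : (w * w') ^ c = w ^ c * w' ^ c := by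
  have h0 := Complex.slitPlane_ne_zero (mem_slitPlane_of_mem_rightHalfPlane hw)
  have h0' := Complex.slitPlane_ne_zero (mem_slitPlane_of_mem_rightHalfPlane hw')
  have h1 := abs_lt.1 (Complex.abs_arg_lt_pi_div_two_iff.2 (Or.inl hw))
  have h2 := abs_lt.1 (Complex.abs_arg_lt_pi_div_two_iff.2 (Or.inl hw'))
  rw [Complex.cpow_def_of_ne_zero (mul_ne_zero h0 h0'), Complex.cpow_def_of_ne_zero h0,
    Complex.cpow_def_of_ne_zero h0', ← Complex.exp_add,
    Complex.log_mul h0 h0' ⟨by linarith [h1.1, h2.1], by linarith [h1.2, h2.2]⟩, add_mul]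

/-- The transformation formula in terms of `w = x + v` and `w' = x - v`, for any series whose terms
are the Beta means of the exponentials. -/
theorem bessel_series_transformation {k : ℕ} (hk : 1 ≤ k) {x y v D : ℂ} (θ : ℝ)
    (hw : x + v ∈ rightHalfPlane) (hw' : x - v ∈ rightHalfPlane) (hD : D = (x + v) * (x - v))
    {t t' : ℕ+ → ℂ}
    (ht : ∀ n : ℕ+, t n = besselFactor k y θ *
      ((sumSqReps k n : ℂ) * betaMeanExp k n (x + v) (x - v)))
    (ht' : ∀ n : ℕ+, t' n = besselFactor k (y / D) (θ - D.arg) *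
      ((sumSqReps k n : ℂ) * betaMeanExp k n (x / D + v / D) (x / D - v / D))) :
    Summable t ∧ Summable t' ∧
      thetaConst k y θ + ∑' n : ℕ+, t n = thetaConst k y θ / D ^ ((k : ℂ) / 4) +
        1 / D ^ (1 / 2 : ℂ) * ∑' n : ℕ+, t' n := by
  have h0 := Complex.slitPlane_ne_zero (mem_slitPlane_of_mem_rightHalfPlane hw)
  have h0' := Complex.slitPlane_ne_zero (mem_slitPlane_of_mem_rightHalfPlane hw')
  have hD0 : D ≠ 0 := hD ▸ mul_ne_zero h0 h0'
  -- Inversion exchanges the roles of the two endpoints, which the symmetry of the mean later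
  -- undoes.
  have e1 : x / D + v / D = (x - v)⁻¹ := by
    rw [hD]
    field_simp
  have e2 : x / D - v / D = (x + v)⁻¹ := by
    rw [hD]
    field_simp
  rw [e1, e2] at ht'
  have hs := (hasSum_pnat_betaMeanExp hk hw hw').mul_left (besselFactor k y θ)
  have hs' := (hasSum_pnat_betaMeanExp hk (inv_mem_rightHalfPlane hw')
    (inv_mem_rightHalfPlane hw)).mul_left (besselFactor k (y / D) (θ - D.arg))
  replace hs := hs.congr_fun ht
  replace hs' := hs'.congr_fun ht'
  refine ⟨hs.summable, hs'.summable, ?_⟩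
  have hmod := betaMean_inv (a := k / 4) (by positivity) (differentiableOn_sqTheta.pow k)
    (fun τ hτ => sqTheta_pow_inv k hτ) hw hw'
  rw [← mul_cpow_of_mem_rightHalfPlane hw hw', ← hD, betaMean_swap _ _ (x + v)⁻¹,
    Complex.cpow_neg] at hmod
  simp only [Pi.pow_def] at hmod
  push_cast at hmod
  -- Of the weight factor `D^(k/4)`, the part `D^ν` is absorbed by `besselFactor_div`, leaving the
  -- `D^(1/2)` in front of the series.
  have hpow : D ^ ((k : ℂ) / 4) = D ^ (1 / 2 : ℂ) * D ^ ((k : ℂ) / 4 - 1 / 2) := by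
    rw [← Complex.cpow_add _ _ hD0]
    congr 1
    ring
  have hne : D ^ (1 / 2 : ℂ) ≠ 0 := by simp [Complex.cpow_eq_zero_iff, hD0]
  have hne' : D ^ ((k : ℂ) / 4 - 1 / 2) ≠ 0 := by simp [Complex.cpow_eq_zero_iff, hD0]
  -- The mean for `n = 0` is the same for both pairs of endpoints, so the constant terms on the two
  -- sides match the terms removed from the full sums.
  rw [hs.tsum_eq, hs'.tsum_eq, besselFactor_div k y hD0, thetaConst_eq hk y θ (x + v) (x - v),
    betaMeanExp_zero hk (x - v)⁻¹, ← betaMeanExp_zero hk (x + v) (x - v), hmod, hpow]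
  field_simp
  ring

end

theorem corollary1 (k : ℕ) (hk : 1 ≤ k) (x y : ℂ) (hy : k = 1 → y ≠ 0)
    (θ : ℝ) (hθ : IsArgOf θ y) :
    (|y.im| < x.re →
      Summable (thetaJTerm k x y θ) ∧
      Summable (thetaJTerm k (x / (x ^ 2 + y ^ 2)) (y / (x ^ 2 + y ^ 2))
        (θ - (x ^ 2 + y ^ 2).arg)) ∧
      thetaConst k y θ + ∑' n : ℕ+, thetaJTerm k x y θ n =
        thetaConst k y θ / (x ^ 2 + y ^ 2) ^ ((k : ℂ) / 4) +
          1 / (x ^ 2 + y ^ 2) ^ (1 / 2 : ℂ) *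
            ∑' n : ℕ+, thetaJTerm k (x / (x ^ 2 + y ^ 2)) (y / (x ^ 2 + y ^ 2))
              (θ - (x ^ 2 + y ^ 2).arg) n) ∧
    (|y.re| < x.re →
      Summable (thetaITerm k x y θ) ∧
      Summable (thetaITerm k (x / (x ^ 2 - y ^ 2)) (y / (x ^ 2 - y ^ 2))
        (θ - (x ^ 2 - y ^ 2).arg)) ∧
      thetaConst k y θ + ∑' n : ℕ+, thetaITerm k x y θ n =
        thetaConst k y θ / (x ^ 2 - y ^ 2) ^ ((k : ℂ) / 4) +
          1 / (x ^ 2 - y ^ 2) ^ (1 / 2 : ℂ) *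
            ∑' n : ℕ+, thetaITerm k (x / (x ^ 2 - y ^ 2)) (y / (x ^ 2 - y ^ 2))
              (θ - (x ^ 2 - y ^ 2).arg) n) := by
  constructor
  · intro h
    obtain ⟨h1, h2⟩ := abs_lt.1 h
    -- Since `Re (i y) = -Im y`, the hypothesis says precisely that `x + i y` and `x - i y` lie in
    -- the right half-plane.
    refine bessel_series_transformation (v := Complex.I * y) hk θ ?_ ?_ ?_
      (thetaJTerm_eq hk x y θ) fun n => ?_
    · show 0 < (x + Complex.I * y).re
      simp
      linarith
    · show 0 < (x - Complex.I * y).re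
      simp
      linarith
    · linear_combination y ^ 2 * Complex.I_sq
    · rw [thetaJTerm_eq hk, mul_div_assoc]
  · intro h
    obtain ⟨h1, h2⟩ := abs_lt.1 h
    refine bessel_series_transformation (v := y) hk θ ?_ ?_ (by ring)
      (thetaITerm_eq hk x y θ) fun n => thetaITerm_eq hk _ _ _ n
    · show 0 < (x + y).re
      simp
      linarith
    · show 0 < (x - y).re
      simp
      linarith
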